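/- Let $p,q>0$ with $p+q=1$ and $p\neq q$, and consider the hidden Markov model with hidden states $\{1,2,3,4\}$, outputs $\{0,1\}$ and stepping matrices $$M(0)=\begin{pmatrix}p&0&0&0\\0&1/2&0&0\\1/2&0&0&0\\0&1/2&0&0\end{pmatrix},\qquad M(1)=\begin{pmatrix}0&0&q&0\\0&0&0&1/2\\0&0&0&1/2\\0&0&1/2&0\end{pmatrix},$$ where $M(y)_{ij}=P\big((X_{n+1},Y_{n+1})=(j,y)\mid X_n=i\big)$. Let $\Delta\subset\mathbb{R}^4$ be the simplex of probability (row) vectors and $e$ the column vector of ones. The $\alpha$-chain of the model is the Markov chain on $\Delta$ which from $\alpha$ moves, with probability $\alpha M(y)e$, to $\alpha M(y)/(\alpha M(y)e)$, for each $y\in\{0,1\}$ with $\alpha M(y)e>0$. A nonnegative matrix $D$ is called subrectangular if $\{(i,j):D_{ij}>0\}=R\times C$ for some sets $R$, $C$ of row and column indices. Then: 1. the $\alpha$-chain has exactly one stationary probability distribution on $\Delta$; 2. no nonzero finite product $M(y_1)\cdots M(y_n)$ of stepping matrices is subrectangular; 3. the transition matrix $M(0)+M(1)$ is irreducible, and the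 closure of the set of all positive scalar multiples of finite products of stepping matrices contains a matrix of rank $1$. -/

import Mathlib

open Matrix MeasureTheory ProbabilityTheory

noncomputable section

/-- The transition mechanism of a finite hidden Markov model with hidden states `X` and outputs
`Y`: a family of nonnegative stepping matrices `M y`, whose sum is a stochastic matrix.
The entry `M y i j` is the probability of `(X_{n+1}, Y_{n+1}) = (j, y)` given `X_n = i`. -/
structure HiddenMarkovModel (X Y : Type*) [Fintype X] [DecidableEq X] [Fintype Y] where
  /-- The stepping matrices. -/
  M : Y → Matrix X X ℝ
  nonneg : ∀ y i j, 0 ≤ M y i j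
  sum_mem_rowStochastic : ∑ y, M y ∈ rowStochastic ℝ X

namespace HiddenMarkovModel

variable {X Y : Type*} [Fintype X] [DecidableEq X] [Fintype Y]

/-- The transition matrix `∑ y, M y` of the hidden Markov chain. -/
def transitionMatrix (H : HiddenMarkovModel X Y) : Matrix X X ℝ := ∑ y, H.M y

/-- The product `M y₁ * ⋯ * M yₙ` attached to a word `y₁, …, yₙ`. -/
def word (H : HiddenMarkovModel X Y) (ys : List Y) : Matrix X X ℝ := (ys.map H.M).prod

/-- The cone of all positive scalar multiples of finite products of stepping matrices. -/
def cone (H : HiddenMarkovModel X Y) : Set (Matrix X X ℝ) :=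
  {A | ∃ c : ℝ, 0 < c ∧ ∃ ys : List Y, A = c • H.word ys}

/-- The number `α M(y) e`, the probability of the output `y` from the state `α`. -/
def outputProb (H : HiddenMarkovModel X Y) (y : Y) (α : stdSimplex ℝ X) : ℝ :=
  ∑ j, ((α : X → ℝ) ᵥ* H.M y) j

lemma vecMul_nonneg (H : HiddenMarkovModel X Y) (y : Y) (α : stdSimplex ℝ X) (j : X) :
    0 ≤ ((α : X → ℝ) ᵥ* H.M y) j :=
  Finset.sum_nonneg fun i _ => mul_nonneg (α.2.1 i) (H.nonneg y i j)

lemma outputProb_nonneg (H : HiddenMarkovModel X Y) (y : Y) (α : stdSimplex ℝ X) :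
    0 ≤ H.outputProb y α :=
  Finset.sum_nonneg fun j _ => H.vecMul_nonneg y α j

lemma normalized_mem (H : HiddenMarkovModel X Y) (y : Y) (α : stdSimplex ℝ X)
    (h : H.outputProb y α ≠ 0) :
    (H.outputProb y α)⁻¹ • ((α : X → ℝ) ᵥ* H.M y) ∈ stdSimplex ℝ X := by
  refine ⟨fun j => mul_nonneg (inv_nonneg.2 (H.outputProb_nonneg y α)) (H.vecMul_nonneg y α j), ?_⟩
  simp only [Pi.smul_apply, smul_eq_mul, ← Finset.mul_sum]
  exact inv_mul_cancel₀ h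

open Classical in
/-- The updated state `α M(y) / (α M(y) e)`. If `α M(y) e = 0`, the output `y` has probability
zero from `α`, and the value (here `α`) plays no role in the transition law below. -/
def update (H : HiddenMarkovModel X Y) (y : Y) (α : stdSimplex ℝ X) : stdSimplex ℝ X :=
  if h : H.outputProb y α ≠ 0 then
    ⟨(H.outputProb y α)⁻¹ • ((α : X → ℝ) ᵥ* H.M y), H.normalized_mem y α h⟩
  else α

lemma measurable_vecMul (H : HiddenMarkovModel X Y) (y : Y) :
    Measurable fun α : stdSimplex ℝ X => (α : X → ℝ) ᵥ* H.M y := by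
  have h : Continuous fun α : stdSimplex ℝ X => (α : X → ℝ) ᵥ* H.M y := by fun_prop
  exact h.measurable

lemma measurable_outputProb (H : HiddenMarkovModel X Y) (y : Y) :
    Measurable (H.outputProb y) :=
  Finset.measurable_sum _ fun j _ => (measurable_pi_apply j).comp (H.measurable_vecMul y)

lemma measurable_update (H : HiddenMarkovModel X Y) (y : Y) : Measurable (H.update y) := by
  classical
  have h : (fun α => (H.update y α : X → ℝ)) = fun α => if H.outputProb y α ≠ 0 then
      (H.outputProb y α)⁻¹ • ((α : X → ℝ) ᵥ* H.M y) else (α : X → ℝ) := by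
    funext α
    unfold update
    split_ifs <;> rfl
  have h2 : Measurable fun α => (H.update y α : X → ℝ) := by
    rw [h]
    refine Measurable.ite ?_ ?_ measurable_subtype_coe
    · exact ((measurableSet_singleton 0).preimage (H.measurable_outputProb y)).compl
    · exact (H.measurable_outputProb y).inv.smul (H.measurable_vecMul y)
  exact h2.subtype_mk

/-- The transition kernel of the `α`-chain on the simplex of probability vectors: from `α`, with
probability `α M(y) e`, move to `α M(y) / (α M(y) e)`. -/
def alphaKernel (H : HiddenMarkovModel X Y) : Kernel (stdSimplex ℝ X) (stdSimplex ℝ X) where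
  toFun α := ∑ y, ENNReal.ofReal (H.outputProb y α) • Measure.dirac (H.update y α)
  measurable' := by
    refine Measure.measurable_of_measurable_coe _ fun s hs => ?_
    simp only [Measure.coe_finsetSum, Finset.sum_apply, Measure.smul_apply, smul_eq_mul]
    refine Finset.measurable_sum _ fun y _ => ?_
    exact (H.measurable_outputProb y).ennreal_ofReal.mul
      ((Measure.measurable_coe hs).comp (Measure.measurable_dirac.comp (H.measurable_update y)))

/-- The `α`-chain has exactly one stationary probability distribution. -/
def UniquelyErgodic (H : HiddenMarkovModel X Y) : Prop :=
  ∃! μ : ProbabilityMeasure (stdSimplex ℝ X),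
    Kernel.Invariant H.alphaKernel (μ : Measure (stdSimplex ℝ X))

end HiddenMarkovModel

/-- A nonnegative matrix is subrectangular if the positions of its positive entries form a
Cartesian product of a set of rows and a set of columns. -/
def IsSubrectangular {X : Type*} (D : Matrix X X ℝ) : Prop :=
  ∃ R C : Set X, ∀ i j, 0 < D i j ↔ i ∈ R ∧ j ∈ C

/-- The two stepping matrices of the example, indexed by the outputs `0` and `1`. -/
def kaijserMatrices (p q : ℝ) : Fin 2 → Matrix (Fin 4) (Fin 4) ℝ :=
  ![!![p, 0, 0, 0;
       0, 1 / 2, 0, 0;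
       1 / 2, 0, 0, 0;
       0, 1 / 2, 0, 0],
    !![0, 0, q, 0;
       0, 0, 0, 1 / 2;
       0, 0, 0, 1 / 2;
       0, 0, 1 / 2, 0]]

/-- The hidden Markov model with four hidden states and the two stepping matrices above. -/
def kaijserHMM (p q : ℝ) (hp : 0 < p) (hq : 0 < q) (hpq : p + q = 1) :
    HiddenMarkovModel (Fin 4) (Fin 2) where
  M := kaijserMatrices p q
  nonneg := by
    intro y i j
    fin_cases y <;> fin_cases i <;> fin_cases j <;> simp [kaijserMatrices, hp.le, hq.le]
  sum_mem_rowStochastic := by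
    rw [mem_rowStochastic_iff_sum]
    constructor
    · intro i j
      fin_cases i <;> fin_cases j <;> simp [kaijserMatrices, Fin.sum_univ_two, hp.le, hq.le]
    · intro i
      fin_cases i <;> simp [kaijserMatrices, Fin.sum_univ_two, Fin.sum_univ_four, hpq] <;> norm_num

end

/-! For `f` nonnegative and positively homogeneous of degree one, the weight `α M(y) e` cancels the
normalization, so stationarity gives `∫ f α = ∫ ∑ y, f (α M(y))`
(`integral_eq_integral_sum_vecMul`). Three such `f` force a stationary law onto the vertices. Every
`α M(y)` lies on the edge `{0, 1}` or the edge `{2, 3}`, so the law is carried by these edges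
(`ae_support`). One step multiplies `√(α 0 α 1)` on the first edge by `ρ = √(p/2) + √(q/2)` and
preserves `√(α 2 α 3)` on the second; as `ρ < 1` when `p ≠ q`, the first mean is zero, and then so
is the second. On vertices the `α`-chain is the hidden chain, whose stationary law is unique.

No word is subrectangular because its rows 0 and 1 have disjoint supports. Rank one arises from
normalized powers of `M(0)`, whose nonzero eigenvalues `p` and `1/2` differ. -/

open Filter Topology

/-! ### Stationarity tested on homogeneous functions -/

namespace HiddenMarkovModel

variable {X Y : Type*} [Fintype X] [DecidableEq X] [Fintype Y]

/-- A nonnegative vector with zero sum vanishes, so the default value of `update` does no harm. -/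
lemma vecMul_eq_outputProb_smul_update (H : HiddenMarkovModel X Y) (y : Y)
    (α : stdSimplex ℝ X) :
    (α : X → ℝ) ᵥ* H.M y = H.outputProb y α • (H.update y α : X → ℝ) := by
  by_cases h : H.outputProb y α = 0
  · have h0 := (Finset.sum_eq_zero_iff_of_nonneg fun j _ => H.vecMul_nonneg y α j).1 h
    funext j
    simp [h, h0 j (Finset.mem_univ j)]
  · rw [update, dif_pos h]
    exact (smul_inv_smul₀ h _).symm

lemma update_eq_of_vecMul_eq_smul (H : HiddenMarkovModel X Y) {y : Y} {α β : stdSimplex ℝ X}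
    {c : ℝ} (hc : c ≠ 0) (h : (α : X → ℝ) ᵥ* H.M y = c • (β : X → ℝ)) :
    H.outputProb y α = c ∧ H.update y α = β := by
  have hc' : H.outputProb y α = c := by
    have hβ : ∑ i, (β : X → ℝ) i = 1 := β.2.2
    simp [outputProb, h, ← Finset.mul_sum, hβ]
  refine ⟨hc', Subtype.ext ?_⟩
  have := H.vecMul_eq_outputProb_smul_update y α
  rw [h, hc'] at this
  exact (smul_right_injective _ hc this).symm

lemma lintegral_alphaKernel (H : HiddenMarkovModel X Y) (α : stdSimplex ℝ X)
    {F : stdSimplex ℝ X → ENNReal} (hF : Measurable F) :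
    ∫⁻ β, F β ∂(H.alphaKernel α) = ∑ y, ENNReal.ofReal (H.outputProb y α) * F (H.update y α) := by
  change ∫⁻ β, F β ∂(∑ y, ENNReal.ofReal (H.outputProb y α) • Measure.dirac (H.update y α)) = _
  rw [lintegral_finsetSum_measure]
  simp [lintegral_dirac' _ hF]

/-- For a nonnegative, continuous, positively homogeneous `f`, a stationary distribution of the
`α`-chain gives the same mean to `f α` and to `∑ y, f (α M(y))`. -/
lemma integral_eq_integral_sum_vecMul (H : HiddenMarkovModel X Y)
    {μ : Measure (stdSimplex ℝ X)} (hμ : Kernel.Invariant H.alphaKernel μ)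
    {f : (X → ℝ) → ℝ} (hf : Continuous f) (hf0 : ∀ v, (∀ i, 0 ≤ v i) → 0 ≤ f v)
    (hhom : ∀ c v, 0 ≤ c → f (c • v) = c * f v) :
    ∫ α, f (α : X → ℝ) ∂μ = ∫ α, ∑ y, f ((α : X → ℝ) ᵥ* H.M y) ∂μ := by
  have hfm : Measurable fun α : stdSimplex ℝ X => ENNReal.ofReal (f (α : X → ℝ)) := by
    have : Continuous fun α : stdSimplex ℝ X => f (α : X → ℝ) := by fun_prop
    exact this.measurable.ennreal_ofReal
  have hcont : Continuous fun α : stdSimplex ℝ X => f (α : X → ℝ) := by fun_prop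
  have hcont' : Continuous fun α : stdSimplex ℝ X => ∑ y, f ((α : X → ℝ) ᵥ* H.M y) := by fun_prop
  have hpos : ∀ (α : stdSimplex ℝ X) y, 0 ≤ f ((α : X → ℝ) ᵥ* H.M y) :=
    fun α y => hf0 _ (H.vecMul_nonneg y α)
  rw [integral_eq_lintegral_of_nonneg_ae (ae_of_all _ fun α => hf0 _ α.2.1)
      hcont.measurable.aestronglyMeasurable,
    integral_eq_lintegral_of_nonneg_ae (ae_of_all _ fun α => Finset.sum_nonneg fun y _ => hpos α y)
      hcont'.measurable.aestronglyMeasurable]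
  congr 1
  conv_lhs => rw [← hμ.def]
  rw [Measure.lintegral_bind H.alphaKernel.measurable.aemeasurable hfm.aemeasurable]
  refine lintegral_congr fun α => ?_
  rw [H.lintegral_alphaKernel α hfm, ENNReal.ofReal_sum_of_nonneg fun y _ => hpos α y]
  refine Finset.sum_congr rfl fun y _ => ?_
  -- Homogeneity absorbs the transition probability into the argument of `f`.
  rw [H.vecMul_eq_outputProb_smul_update y α, hhom _ _ (H.outputProb_nonneg y α),
    ENNReal.ofReal_mul (H.outputProb_nonneg y α)]

end HiddenMarkovModel

lemma stdSimplex.integrable_of_continuous {X : Type*} [Fintype X]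
    (μ : Measure (stdSimplex ℝ X)) [IsFiniteMeasure μ] {f : (X → ℝ) → ℝ} (hf : Continuous f) :
    Integrable (fun α : stdSimplex ℝ X => f (α : X → ℝ)) μ := by
  have h : Continuous fun α : stdSimplex ℝ X => f (α : X → ℝ) := by fun_prop
  exact h.integrable_of_hasCompactSupport (HasCompactSupport.of_compactSpace _)

namespace kaijserHMM

variable {p q : ℝ} (hp : 0 < p) (hq : 0 < q) (hpq : p + q = 1)

lemma vecMul_zero (v : Fin 4 → ℝ) :
    v ᵥ* (kaijserHMM p q hp hq hpq).M 0 =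
      ![p * v 0 + v 2 / 2, v 1 / 2 + v 3 / 2, 0, 0] := by
  funext j
  fin_cases j <;>
    simp [kaijserHMM, kaijserMatrices, vecMul, dotProduct, Fin.sum_univ_four] <;> ring

lemma vecMul_one (v : Fin 4 → ℝ) :
    v ᵥ* (kaijserHMM p q hp hq hpq).M 1 =
      ![0, 0, q * v 0 + v 3 / 2, v 1 / 2 + v 2 / 2] := by
  funext j
  fin_cases j <;>
    simp [kaijserHMM, kaijserMatrices, vecMul, dotProduct, Fin.sum_univ_four] <;> ring

/-- One minus the left side is half of `(√p - √(1/2))² + (√q - √(1/2))²`, which vanishes only for `p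
= q = 1/2`. -/
lemma sqrt_half_mul_sqrt_half_lt_one (hp : 0 < p) (hq : 0 < q) (hpq : p + q = 1) (hne : p ≠ q) :
    √p * √(1 / 2) + √q * √(1 / 2) < 1 := by
  have h1 := Real.sq_sqrt hp.le
  have h2 := Real.sq_sqrt hq.le
  have h3 := Real.sq_sqrt (show (0 : ℝ) ≤ 1 / 2 by norm_num)
  have h4 : √p ≠ √(1 / 2) := fun h => by
    rw [Real.sqrt_inj hp.le (by norm_num)] at h
    apply hne
    linarith
  have h5 := sq_pos_of_ne_zero (sub_ne_zero.2 h4)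
  nlinarith [sq_nonneg (√q - √(1 / 2))]

/-! ### Stationary distributions live on the vertices -/

section Stationary

variable {μ : Measure (stdSimplex ℝ (Fin 4))}
  (hμ : Kernel.Invariant (kaijserHMM p q hp hq hpq).alphaKernel μ)

include hμ

lemma integral_eq {f : (Fin 4 → ℝ) → ℝ} (hf : Continuous f)
    (hf0 : ∀ v, (∀ i, 0 ≤ v i) → 0 ≤ f v) (hhom : ∀ c v, 0 ≤ c → f (c • v) = c * f v) :
    ∫ α, f α ∂μ = ∫ α, (f ![p * α 0 + α 2 / 2, α 1 / 2 + α 3 / 2, 0, 0] +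
      f ![0, 0, q * α 0 + α 3 / 2, α 1 / 2 + α 2 / 2]) ∂μ := by
  rw [(kaijserHMM p q hp hq hpq).integral_eq_integral_sum_vecMul hμ hf hf0 hhom]
  simp only [Fin.sum_univ_two, vecMul_zero, vecMul_one]

variable [IsProbabilityMeasure μ]

/-- The test function `√(v 0 + v 1) * √(v 2 + v 3)` vanishes at both `α M(0)` and `α M(1)`, so its
mean is zero. -/
lemma ae_support : ∀ᵐ α ∂μ, (α 0 = 0 ∧ α 1 = 0) ∨ (α 2 = 0 ∧ α 3 = 0) := by
  have hc : Continuous fun v : Fin 4 → ℝ => √(v 0 + v 1) * √(v 2 + v 3) := by fun_prop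
  have h := integral_eq hp hq hpq hμ hc (fun v _ => by positivity) (fun c v hc => by
    simp only [Pi.smul_apply, smul_eq_mul, ← mul_add, Real.sqrt_mul hc]
    linear_combination (√(v 0 + v 1) * √(v 2 + v 3)) * Real.mul_self_sqrt hc)
  simp only [Matrix.cons_val, add_zero, Real.sqrt_zero, mul_zero, zero_mul,
    integral_zero] at h
  rw [integral_eq_zero_iff_of_nonneg (fun α => by positivity)
    (stdSimplex.integrable_of_continuous μ hc)] at h
  filter_upwards [h] with α hα
  have h0 : ∀ i, 0 ≤ α i := α.2.1
  simp only [Pi.zero_apply, mul_eq_zero] at hα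
  rw [Real.sqrt_eq_zero (add_nonneg (h0 0) (h0 1)), Real.sqrt_eq_zero (add_nonneg (h0 2) (h0 3)),
    add_eq_zero_iff_of_nonneg (h0 0) (h0 1), add_eq_zero_iff_of_nonneg (h0 2) (h0 3)] at hα
  exact hα

lemma ae_mul_eq_zero_left (hne : p ≠ q) : ∀ᵐ α ∂μ, √(α 0) * √(α 1) = 0 := by
  have hc : Continuous fun v : Fin 4 → ℝ => √(v 0) * √(v 1) + √(v 2) * √(v 3) := by fun_prop
  have hc' : Continuous fun v : Fin 4 → ℝ => √(v 0) * √(v 1) := by fun_prop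
  have h := integral_eq hp hq hpq hμ hc (fun v _ => by positivity) (fun c v hc => by
    simp only [Pi.smul_apply, smul_eq_mul, Real.sqrt_mul hc]
    linear_combination (√(v 0) * √(v 1) + √(v 2) * √(v 3)) * Real.mul_self_sqrt hc)
  have h2 : ∫ α : stdSimplex ℝ (Fin 4), √(α 0) * √(α 1) ∂μ = 0 := by
    set ρ := √p * √(1 / 2) + √q * √(1 / 2) with hρ
    have hlt : ρ < 1 := sqrt_half_mul_sqrt_half_lt_one hp hq hpq hne
    -- On edge `{0, 1}` a step scales the test function by `ρ`; on edge `{2, 3}` each output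
    -- contributes one half, so nothing is lost.
    replace h := h.trans (integral_congr_ae
      (g := fun α => (√(α 0) * √(α 1) + √(α 2) * √(α 3)) - (1 - ρ) * (√(α 0) * √(α 1))) ?_)
    · rw [integral_sub (stdSimplex.integrable_of_continuous μ hc)
        ((stdSimplex.integrable_of_continuous μ hc').const_mul _), integral_const_mul] at h
      have : (1 - ρ) * ∫ α : stdSimplex ℝ (Fin 4), √(α 0) * √(α 1) ∂μ = 0 := by linarith
      exact (mul_eq_zero.1 this).resolve_left (by linarith)
    · filter_upwards [ae_support hp hq hpq hμ] with α hα
      have h0 : ∀ i, 0 ≤ α i := α.2.1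
      simp only [Matrix.cons_val, Real.sqrt_zero, mul_zero, add_zero, zero_add]
      have h3 := Real.mul_self_sqrt (show (0 : ℝ) ≤ 1 / 2 by norm_num)
      rcases hα with ⟨ha, hb⟩ | ⟨ha, hb⟩
      · simp only [ha, hb, mul_zero, zero_add, zero_div, Real.sqrt_zero, sub_zero,
          div_eq_mul_one_div (α _), Real.sqrt_mul (h0 _)]
        linear_combination (2 * √(α 2) * √(α 3)) * h3
      · simp only [ha, hb, zero_div, add_zero, Real.sqrt_zero, mul_zero,
          div_eq_mul_one_div (α _), Real.sqrt_mul (h0 _), Real.sqrt_mul hp.le,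
          Real.sqrt_mul hq.le, hρ]
        ring
  rwa [integral_eq_zero_iff_of_nonneg (fun α => by positivity)
    (stdSimplex.integrable_of_continuous μ hc')] at h2

/-- Output 0 carries edge `{2, 3}` to edge `{0, 1}`, where the mean is already known to vanish. -/
lemma ae_mul_eq_zero_right (hne : p ≠ q) : ∀ᵐ α ∂μ, √(α 2) * √(α 3) = 0 := by
  have hc : Continuous fun v : Fin 4 → ℝ => √(v 0) * √(v 1) := by fun_prop
  have hc' : Continuous fun v : Fin 4 → ℝ => √(v 2) * √(v 3) := by fun_prop
  have h := integral_eq hp hq hpq hμ hc (fun v _ => by positivity) (fun c v hc => by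
    simp only [Pi.smul_apply, smul_eq_mul, Real.sqrt_mul hc]
    linear_combination (√(v 0) * √(v 1)) * Real.mul_self_sqrt hc)
  have h2 : ∫ α : stdSimplex ℝ (Fin 4), √(α 2) * √(α 3) ∂μ = 0 := by
    have hz := ae_mul_eq_zero_left hp hq hpq hμ hne
    rw [integral_eq_zero_of_ae hz, integral_congr_ae
      (g := fun α => (1 / 2) * (√(α 2) * √(α 3))), integral_const_mul] at h
    · linarith
    · filter_upwards [ae_support hp hq hpq hμ, hz] with α hα hz
      have h0 : ∀ i, 0 ≤ α i := α.2.1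
      have h3 := Real.mul_self_sqrt (show (0 : ℝ) ≤ 1 / 2 by norm_num)
      simp only [Matrix.cons_val, Real.sqrt_zero, mul_zero, add_zero]
      rcases hα with ⟨ha, hb⟩ | ⟨ha, hb⟩
      · simp only [ha, hb, mul_zero, zero_add, zero_div,
          div_eq_mul_one_div (α _), Real.sqrt_mul (h0 _)]
        linear_combination (√(α 2) * √(α 3)) * h3
      · simp only [ha, hb, zero_div, add_zero, Real.sqrt_zero, mul_zero,
          div_eq_mul_one_div (α _), Real.sqrt_mul (h0 _), Real.sqrt_mul hp.le]
        linear_combination (√p * √(1 / 2)) * hz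
  rwa [integral_eq_zero_iff_of_nonneg (fun α => by positivity)
    (stdSimplex.integrable_of_continuous μ hc')] at h2

/-- A stationary distribution of the `α`-chain charges only the vertices of the simplex. -/
lemma ae_eq_vertex (hne : p ≠ q) : ∀ᵐ α ∂μ, ∃ i : Fin 4, α = stdSimplex.vertex i := by
  filter_upwards [ae_support hp hq hpq hμ, ae_mul_eq_zero_left hp hq hpq hμ hne,
    ae_mul_eq_zero_right hp hq hpq hμ hne] with α h1 h2 h3
  have h0 : ∀ i, 0 ≤ α i := α.2.1
  rw [mul_eq_zero, Real.sqrt_eq_zero (h0 _), Real.sqrt_eq_zero (h0 _)] at h2 h3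
  have key : ∃ i : Fin 4, ∀ j, j ≠ i → α j = 0 := by
    rcases h1 with ⟨ha, hb⟩ | ⟨ha, hb⟩
    · rcases h3 with hc | hc
      · exact ⟨3, fun j hj => by fin_cases j <;> first | assumption | exact absurd rfl hj⟩
      · exact ⟨2, fun j hj => by fin_cases j <;> first | assumption | exact absurd rfl hj⟩
    · rcases h2 with hc | hc
      · exact ⟨1, fun j hj => by fin_cases j <;> first | assumption | exact absurd rfl hj⟩
      · exact ⟨0, fun j hj => by fin_cases j <;> first | assumption | exact absurd rfl hj⟩
  obtain ⟨i, hi⟩ := key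
  refine ⟨i, stdSimplex.ext (funext fun j => ?_)⟩
  rcases eq_or_ne j i with rfl | hj
  · have : ∑ k, α k = α j := Finset.sum_eq_single j (fun k _ hk => hi k hk) (by simp)
    have h1 : ∑ k, α k = 1 := α.2.2
    simpa [stdSimplex.vertex] using this.symm.trans h1
  · simpa [stdSimplex.vertex, hj] using hi j hj

/-- The barycentre of a stationary distribution is stationary for the hidden chain. -/
lemma integral_apply (i : Fin 4) :
    ∫ α : stdSimplex ℝ (Fin 4), α i ∂μ = ![1, 2 * q, 2 * q, 2 * q] i / (1 + 6 * q) := by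
  have hint : ∀ i, Integrable (fun α : stdSimplex ℝ (Fin 4) => α i) μ := fun i =>
    stdSimplex.integrable_of_continuous μ (f := fun v => v i) (by fun_prop)
  have hb := fun i : Fin 4 => integral_eq hp hq hpq hμ (f := fun v => v i) (by fun_prop)
    (fun v hv => hv i) (fun c v _ => rfl)
  have hs : ∑ i : Fin 4, ∫ α : stdSimplex ℝ (Fin 4), α i ∂μ = 1 := by
    rw [← integral_finsetSum _ fun i _ => hint i]
    have : ∀ α : stdSimplex ℝ (Fin 4), ∑ i, α i = 1 := fun α => α.2.2
    simp [this]
  -- The balance equation at state 2 follows from these three, since the rows of the transition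
  -- matrix sum to one.
  have h0 := hb 0
  have h1 := hb 1
  have h3 := hb 3
  simp only [Matrix.cons_val, add_zero, zero_add] at h0 h1 h3
  rw [integral_add ((hint 0).const_mul p) ((hint 2).div_const 2), integral_const_mul,
    integral_div] at h0
  rw [integral_add ((hint 1).div_const 2) ((hint 3).div_const 2), integral_div,
    integral_div] at h1
  rw [integral_add ((hint 1).div_const 2) ((hint 2).div_const 2), integral_div,
    integral_div] at h3
  rw [Fin.sum_univ_four] at hs
  obtain rfl : p = 1 - q := by linarith
  rw [eq_div_iff (by positivity)]
  clear hb
  generalize hm : (fun i => ∫ α : stdSimplex ℝ (Fin 4), α i ∂μ) = m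
  have hm' : ∀ i, ∫ α : stdSimplex ℝ (Fin 4), α i ∂μ = m i := fun i => congrFun hm i
  simp only [hm'] at h0 h1 h3 hs ⊢
  have e2 : m 2 = 2 * q * m 0 := by linarith
  have e1 : m 1 = 2 * q * m 0 := by linarith
  have e3 : m 3 = 2 * q * m 0 := by linarith
  have e0 : m 0 * (1 + 6 * q) = 1 := by rw [e1, e2, e3] at hs; linarith
  fin_cases i
  · simpa using e0
  all_goals simp [e1, e2, e3]; linear_combination (2 * q) * e0

/-- At a vertex, `g α = ∑ i, α i * g (vertex i)`, so the coordinate means determine every integral.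
-/
lemma integral_eq_sum (hne : p ≠ q) {g : stdSimplex ℝ (Fin 4) → ℝ} :
    ∫ α, g α ∂μ = ∑ i, ![1, 2 * q, 2 * q, 2 * q] i / (1 + 6 * q) * g (stdSimplex.vertex i) := by
  have hint : ∀ i, Integrable (fun α : stdSimplex ℝ (Fin 4) => α i) μ := fun i =>
    stdSimplex.integrable_of_continuous μ (f := fun v => v i) (by fun_prop)
  rw [integral_congr_ae (g := fun α => ∑ i, α i * g (stdSimplex.vertex i)),
    integral_finsetSum _ fun i _ => (hint i).mul_const _]
  · simp only [integral_mul_const, integral_apply hp hq hpq hμ]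
  · filter_upwards [ae_eq_vertex hp hq hpq hμ hne] with α ⟨i, hi⟩
    simp [hi, stdSimplex.vertex, Pi.single_apply]

end Stationary

/-! ### Words are not subrectangular -/

/-- The first two and the last two rows of every word have disjoint, nonempty supports. -/
lemma exists_pos_of_word (ys : List (Fin 2)) {i i' : Fin 4}
    (h : (i = 0 ∧ i' = 1) ∨ (i = 2 ∧ i' = 3)) :
    ∃ j k, 0 < (kaijserHMM p q hp hq hpq).word ys i j ∧
      0 < (kaijserHMM p q hp hq hpq).word ys i' k ∧
      (kaijserHMM p q hp hq hpq).word ys i k = 0 ∧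
      (kaijserHMM p q hp hq hpq).word ys i' j = 0 := by
  induction ys generalizing i i' with
  | nil =>
    refine ⟨i, i', ?_⟩
    rcases h with ⟨rfl, rfl⟩ | ⟨rfl, rfl⟩ <;> simp [HiddenMarkovModel.word]
  | cons y ys ih =>
    obtain ⟨j, k, h1, h2, h3, h4⟩ := ih (i := 0) (i' := 1) (by simp)
    obtain ⟨j', k', h1', h2', h3', h4'⟩ := ih (i := 2) (i' := 3) (by simp)
    have hw : (kaijserHMM p q hp hq hpq).word (y :: ys) =
      kaijserMatrices p q y * (kaijserHMM p q hp hq hpq).word ys := by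
        simp [HiddenMarkovModel.word, kaijserHMM]
    rw [hw]
    have hy : y = 0 ∨ y = 1 := by fin_cases y <;> simp
    -- Each row of a stepping matrix has a single positive entry, so a row of the longer word is a
    -- multiple of a row of `ys`. Output 0 sends either pair of rows to `(0, 1)`; output 1 sends
    -- `(0, 1)` to `(2, 3)` and `(2, 3)` to `(3, 2)`, hence the swapped last witnesses.
    rcases hy with rfl | rfl <;> rcases h with ⟨rfl, rfl⟩ | ⟨rfl, rfl⟩
    · exact ⟨j, k, by simp [kaijserMatrices, mul_apply, Fin.sum_univ_four, *]⟩
    · exact ⟨j, k, by simp [kaijserMatrices, mul_apply, Fin.sum_univ_four, *]⟩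
    · exact ⟨j', k', by simp [kaijserMatrices, mul_apply, Fin.sum_univ_four, *]⟩
    · exact ⟨k', j', by simp [kaijserMatrices, mul_apply, Fin.sum_univ_four, *]⟩

lemma not_isSubrectangular_word (ys : List (Fin 2)) :
    ¬ IsSubrectangular ((kaijserHMM p q hp hq hpq).word ys) := by
  rintro ⟨R, C, h⟩
  obtain ⟨j, k, h1, h2, h3, -⟩ := exists_pos_of_word hp hq hpq ys (i := 0) (i' := 1) (by simp)
  exact ((h 0 k).2 ⟨((h 0 j).1 h1).1, ((h 1 k).1 h2).2⟩).ne' h3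

/-! ### Irreducibility and a rank-one limit -/

lemma transitionMatrix_eq : (kaijserHMM p q hp hq hpq).transitionMatrix =
    !![p, 0, q, 0; 0, 1 / 2, 0, 1 / 2; 1 / 2, 0, 0, 1 / 2; 0, 1 / 2, 1 / 2, 0] := by
  ext i j
  fin_cases i <;> fin_cases j <;>
    simp [HiddenMarkovModel.transitionMatrix, Fin.sum_univ_two, kaijserHMM, kaijserMatrices]

lemma isIrreducible_transitionMatrix :
    (kaijserHMM p q hp hq hpq).transitionMatrix.IsIrreducible := by
  rw [transitionMatrix_eq]
  -- The third power is entrywise positive.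
  refine IsPrimitive.isIrreducible ⟨fun i j => ?_, 3, by norm_num, fun i j => ?_⟩
  · fin_cases i <;> fin_cases j <;> simp [hp.le, hq.le]
  · fin_cases i <;> fin_cases j <;> simp [pow_succ, mul_apply, Fin.sum_univ_four] <;> positivity

/-- The powers of the first stepping matrix. -/
lemma word_replicate_zero (n : ℕ) :
    (kaijserHMM p q hp hq hpq).word (List.replicate (n + 1) 0) =
      !![p ^ (n + 1), 0, 0, 0; 0, (1 / 2) ^ (n + 1), 0, 0;
        p ^ n / 2, 0, 0, 0; 0, (1 / 2) ^ (n + 1), 0, 0] := by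
  induction n with
  | zero =>
    ext i j
    fin_cases i <;> fin_cases j <;> simp [HiddenMarkovModel.word, kaijserHMM, kaijserMatrices]
  | succ n ih =>
    have hw : (kaijserHMM p q hp hq hpq).word (List.replicate (n + 1 + 1) 0) =
        kaijserMatrices p q 0 * (kaijserHMM p q hp hq hpq).word (List.replicate (n + 1) 0) := by
      simp [HiddenMarkovModel.word, kaijserHMM, List.replicate_succ]
    rw [hw, ih]
    ext i j
    fin_cases i <;> fin_cases j <;>
      simp [kaijserMatrices, mul_apply, Fin.sum_univ_four] <;> ring

lemma mem_closure_cone_of_tendsto {c : ℕ → ℝ} (hc : ∀ n, 0 < c n) {A : Matrix (Fin 4) (Fin 4) ℝ}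
    (h : ∀ i j, Tendsto (fun n => c n *
      (kaijserHMM p q hp hq hpq).word (List.replicate (n + 1) 0) i j) atTop (𝓝 (A i j))) :
    A ∈ closure (kaijserHMM p q hp hq hpq).cone :=
  mem_closure_of_tendsto (f := fun n =>
      c n • (kaijserHMM p q hp hq hpq).word (List.replicate (n + 1) 0))
    (tendsto_pi_nhds.2 fun i => tendsto_pi_nhds.2 fun j => h i j)
    (Eventually.of_forall fun n => ⟨c n, hc n, _, rfl⟩)

lemma rank_vecMulVec_eq_one {n : Type*} [Fintype n] [DecidableEq n] {w v : n → ℝ}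
    (hw : w ≠ 0) (hv : v ≠ 0) : (vecMulVec w v).rank = 1 := by
  refine le_antisymm (rank_vecMulVec_le w v) (Nat.one_le_iff_ne_zero.2 fun h => ?_)
  rw [Matrix.rank, Submodule.finrank_eq_zero, LinearMap.range_eq_bot,
    ← Matrix.toLin'_apply', map_eq_zero_iff _ Matrix.toLin'.injective] at h
  exact vecMulVec_ne_zero hw hv h

/-- Dividing the powers of `M(0)` by those of its larger eigenvalue, `1/2` or `p`, kills the other
eigenvalue's contribution and leaves one nonzero column. -/
lemma exists_rank_eq_one (hne : p ≠ q) :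
    ∃ A ∈ closure (kaijserHMM p q hp hq hpq).cone, A.rank = 1 := by
  rcases lt_or_ge p (1 / 2) with h | h
  · refine ⟨vecMulVec ![0, 1, 0, 1] ![0, 1, 0, 0],
      mem_closure_cone_of_tendsto hp hq hpq (c := fun n => 2 ^ (n + 1)) (fun n => by positivity)
      fun i j => ?_, rank_vecMulVec_eq_one (fun h => ?_) (fun h => ?_)⟩
    · have h0 : Tendsto (fun n : ℕ => (2 * p) ^ n) atTop (𝓝 0) :=
        tendsto_pow_atTop_nhds_zero_of_lt_one (by linarith) (by linarith)
      have h1 : Tendsto (fun n : ℕ => (2 : ℝ) ^ (n + 1) * p ^ (n + 1)) atTop (𝓝 0) := by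
        simpa [← mul_pow] using (tendsto_add_atTop_iff_nat 1).2 h0
      have h2 : Tendsto (fun n : ℕ => (2 : ℝ) ^ (n + 1) * (p ^ n / 2)) atTop (𝓝 0) :=
        h0.congr fun n => by rw [mul_pow]; ring
      simp only [word_replicate_zero]
      fin_cases i <;> fin_cases j <;> simp [vecMulVec_apply, h1, h2]
    · simpa using congrFun h 1
    · simpa using congrFun h 1
  · have hlt : 1 / 2 < p := lt_of_le_of_ne h fun h => hne (by linarith)
    -- The entry `p⁻¹ / 2` is `p ^ n / 2` divided by `p ^ (n + 1)`.
    refine ⟨vecMulVec ![1, 0, p⁻¹ / 2, 0] ![1, 0, 0, 0],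
      mem_closure_cone_of_tendsto hp hq hpq (c := fun n => p⁻¹ ^ (n + 1)) (fun n => by positivity)
      fun i j => ?_, rank_vecMulVec_eq_one (fun h => ?_) (fun h => ?_)⟩
    · have h0 : Tendsto (fun n : ℕ => (p⁻¹ * (1 / 2)) ^ n) atTop (𝓝 0) :=
        tendsto_pow_atTop_nhds_zero_of_lt_one (by positivity) (by
          rw [inv_mul_lt_iff₀ hp]; linarith)
      have h1 : Tendsto (fun n : ℕ => (p ^ (n + 1))⁻¹ * (2 ^ (n + 1))⁻¹) atTop (𝓝 0) := by
        simpa [mul_pow] using (tendsto_add_atTop_iff_nat 1).2 h0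
      have h2 : ∀ n : ℕ, (p ^ (n + 1))⁻¹ * (p ^ n / 2) = p⁻¹ / 2 :=
        fun n => by field_simp; ring
      have h3 : ∀ n : ℕ, (p ^ (n + 1))⁻¹ * p ^ (n + 1) = 1 :=
        fun n => inv_mul_cancel₀ (by positivity)
      simp only [word_replicate_zero]
      fin_cases i <;> fin_cases j <;> simp [vecMulVec_apply, h1, h2, h3]
    · simpa using congrFun h 0
    · simpa using congrFun h 0

/-! ### Existence and uniqueness of the stationary distribution -/

/-- The stationary distribution, carried by the vertices of the simplex. -/
noncomputable def stationaryMeasure (q : ℝ) : Measure (stdSimplex ℝ (Fin 4)) :=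
  ∑ i, ENNReal.ofReal (![1, 2 * q, 2 * q, 2 * q] i / (1 + 6 * q)) •
    Measure.dirac (stdSimplex.vertex i)

lemma isProbabilityMeasure_stationaryMeasure {q : ℝ} (hq : 0 < q) :
    IsProbabilityMeasure (stationaryMeasure q) := by
  refine ⟨?_⟩
  simp only [stationaryMeasure, Measure.coe_finsetSum, Finset.sum_apply, Measure.smul_apply,
    measure_univ, smul_eq_mul, mul_one]
  rw [← ENNReal.ofReal_sum_of_nonneg fun i _ => by fin_cases i <;> simp <;> positivity,
    ENNReal.ofReal_eq_one, Fin.sum_univ_four]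
  simp
  field_simp
  ring

lemma vertex_vecMul (M : Matrix (Fin 4) (Fin 4) ℝ) (i : Fin 4) :
    (stdSimplex.vertex (S := ℝ) i : Fin 4 → ℝ) ᵥ* M = M i :=
  single_one_vecMul i M

/-- At the vertices, the `α`-chain moves like the hidden chain. -/
lemma lintegral_alphaKernel_vertex {F : stdSimplex ℝ (Fin 4) → ENNReal} (hF : Measurable F)
    (i : Fin 4) :
    ∫⁻ β, F β ∂((kaijserHMM p q hp hq hpq).alphaKernel (stdSimplex.vertex i)) =
      ENNReal.ofReal (![p, 1 / 2, 1 / 2, 1 / 2] i) * F (stdSimplex.vertex (![0, 1, 0, 1] i)) +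
      ENNReal.ofReal (![q, 1 / 2, 1 / 2, 1 / 2] i) *
        F (stdSimplex.vertex (![2, 3, 3, 2] i)) := by
  obtain ⟨h1, h2⟩ := (kaijserHMM p q hp hq hpq).update_eq_of_vecMul_eq_smul (y := 0)
    (α := stdSimplex.vertex i) (β := stdSimplex.vertex (![0, 1, 0, 1] i))
    (c := ![p, 1 / 2, 1 / 2, 1 / 2] i) (by fin_cases i <;> simp [hp.ne']) (by
      rw [vertex_vecMul]
      funext j
      fin_cases i <;> fin_cases j <;> simp [kaijserHMM, kaijserMatrices, stdSimplex.vertex])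
  obtain ⟨h3, h4⟩ := (kaijserHMM p q hp hq hpq).update_eq_of_vecMul_eq_smul (y := 1)
    (α := stdSimplex.vertex i) (β := stdSimplex.vertex (![2, 3, 3, 2] i))
    (c := ![q, 1 / 2, 1 / 2, 1 / 2] i) (by fin_cases i <;> simp [hq.ne']) (by
      rw [vertex_vecMul]
      funext j
      fin_cases i <;> fin_cases j <;> simp [kaijserHMM, kaijserMatrices, stdSimplex.vertex])
  rw [HiddenMarkovModel.lintegral_alphaKernel _ _ hF, Fin.sum_univ_two, h1, h2, h3, h4]

lemma invariant_stationaryMeasure :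
    Kernel.Invariant (kaijserHMM p q hp hq hpq).alphaKernel (stationaryMeasure q) := by
  refine Measure.ext_of_lintegral _ fun F hF => ?_
  rw [Measure.lintegral_bind (Kernel.measurable _).aemeasurable hF.aemeasurable]
  simp only [stationaryMeasure, lintegral_finsetSum_measure, lintegral_smul_measure,
    lintegral_dirac' _ hF, lintegral_dirac' _ (hF.lintegral_kernel),
    lintegral_alphaKernel_vertex hp hq hpq hF, smul_eq_mul]
  simp only [Fin.sum_univ_four, Matrix.cons_val, mul_add, ← mul_assoc]
  have hr : 0 ≤ 2 * q / (1 + 6 * q) := by positivity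
  have hr' : 0 ≤ 1 / (1 + 6 * q) := by positivity
  rw [← ENNReal.ofReal_mul hr, ← ENNReal.ofReal_mul hr', ← ENNReal.ofReal_mul hr']
  -- These are the balance equations for the weights, moved to `ENNReal`, where `ring` can finish.
  have e0 : ENNReal.ofReal (1 / (1 + 6 * q)) = ENNReal.ofReal (1 / (1 + 6 * q) * p) +
      ENNReal.ofReal (2 * q / (1 + 6 * q) * (1 / 2)) := by
    rw [← ENNReal.ofReal_add (by positivity) (by positivity)]
    congr 1
    linear_combination (-1 / (1 + 6 * q)) * hpq
  have e1 : ENNReal.ofReal (1 / (1 + 6 * q) * q) =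
      ENNReal.ofReal (2 * q / (1 + 6 * q) * (1 / 2)) := by
    congr 1
    ring
  have e2 : ENNReal.ofReal (2 * q / (1 + 6 * q)) =
      ENNReal.ofReal (2 * q / (1 + 6 * q) * (1 / 2)) +
      ENNReal.ofReal (2 * q / (1 + 6 * q) * (1 / 2)) := by
    rw [← ENNReal.ofReal_add (by positivity) (by positivity)]
    congr 1
    ring
  rw [e0, e1, e2]
  ring

theorem uniquelyErgodic (hne : p ≠ q) : (kaijserHMM p q hp hq hpq).UniquelyErgodic := by
  refine ⟨⟨stationaryMeasure q, isProbabilityMeasure_stationaryMeasure hq⟩,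
    invariant_stationaryMeasure hp hq hpq, fun ⟨μ, hprob⟩ hμ => Subtype.ext ?_⟩
  have := isProbabilityMeasure_stationaryMeasure hq
  change μ = stationaryMeasure q
  replace hμ : Kernel.Invariant _ μ := hμ
  refine ext_of_forall_integral_eq_of_IsFiniteMeasure fun g => ?_
  -- The explicit measure is itself stationary, so the same formula evaluates both integrals.
  exact (integral_eq_sum hp hq hpq hμ hne).trans
    (integral_eq_sum hp hq hpq (invariant_stationaryMeasure hp hq hpq) hne).symm

end kaijserHMM

theorem mainTheorem4 (p q : ℝ) (hp : 0 < p) (hq : 0 < q) (hpq : p + q = 1) (hne : p ≠ q) :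
    (kaijserHMM p q hp hq hpq).UniquelyErgodic ∧
    (∀ ys : List (Fin 2), (kaijserHMM p q hp hq hpq).word ys ≠ 0 →
      ¬ IsSubrectangular ((kaijserHMM p q hp hq hpq).word ys)) ∧
    (kaijserHMM p q hp hq hpq).transitionMatrix.IsIrreducible ∧
    (∃ A ∈ closure (kaijserHMM p q hp hq hpq).cone, A.rank = 1) :=
  ⟨kaijserHMM.uniquelyErgodic hp hq hpq hne,
    fun ys _ => kaijserHMM.not_isSubrectangular_word hp hq hpq ys,
    kaijserHMM.isIrreducible_transitionMatrix hp hq hpq,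
    kaijserHMM.exists_rank_eq_one hp hq hpq hne⟩
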